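/- **Languages.** Let $\mathtt{Prop}$ be a countably infinite set of propositional variables. Classical formulas are built from $\mathtt{Prop}$ with ${\sim}$ and $\wedge$ ($\vee$, $\supset$, $\top$, $\bot$ are the usual abbreviations); $\mathsf{CPL}\vdash\phi$ means that $\phi$ is a classical tautology. Two-layered formulas are $\alpha::=\mathtt{B}\phi\mid\alpha\wedge\alpha\mid\alpha\vee\alpha\mid\alpha\to_{\mathsf G}\alpha\mid\alpha\prec_{\mathsf G}\alpha$ with $\phi$ classical, and for a fixed atom $\beta=\mathtt{B}p$ we put $\top_{\mathsf G}:=\beta\to_{\mathsf G}\beta$, $\bot_{\mathsf G}:=\beta\prec_{\mathsf G}\beta$, ${\sim}_{\mathsf G}\alpha:=\alpha\to_{\mathsf G}\bot_{\mathsf G}$, $\triangle\alpha:=(\top_{\mathsf G}\prec_{\mathsf G}\alpha)\to_{\mathsf G}\bot_{\mathsf G}$, $\alpha\leftrightarrow_{\mathsf G}\alpha':=(\alpha\to_{\mathsf G}\alpha')\wedge(\alpha'\to_{\mathsf G}\alpha)$. **Semantics.** A frame is $\mathbb F=\langle W,\mu\rangle$ with $W\neq\varnothing$ and $\mu:2^W\to[0,1]$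 an uncertainty measure, i.e. $\mu$ is monotone with respect to $\subseteq$ and $\mu(\varnothing)<\mu(W)$. A valuation $v:\mathtt{Prop}\to2^W$ extends to $\|\phi\|\subseteq W$ classically and induces $e(\mathtt{B}\phi)=\mu(\|\phi\|)$, where $\wedge,\vee$ are interpreted as $\min,\max$, $a\to_{\mathsf G}b$ is $1$ if $a\le b$ and $b$ otherwise, and $a\prec_{\mathsf G}b$ is $0$ if $a\le b$ and $a$ otherwise. $\mathbb F\models\alpha$ means $e(\alpha)=1$ for all $v$ on $\mathbb F$. The measure $\mu$ satisfies the Kraft–Pratt–Seidenberg conditions if for all $m\in\mathbb N$ and $X_0,\dots,X_m,Y_0,\dots,Y_m\subseteq W$: if $\mu(X_j)\le\mu(Y_j)$ for all $j<m$ and every $w\in W$ belongs to as many $X_i$'s as $Y_i$'s, then $\mu(X_m)\ge\mu(Y_m)$; then $\mathbb F$ is called a $\mathsf{QPG}$ frame. $\Xi\models_{\mathsf{QPG}}\alpha$ means that $\inf\{e(\gamma):\gamma\in\Xi\}\le e(\alpha)$ (infimum in $[0,1]$) for every valuation on every $\mathsf{QPG}$ frame. **Axioms.** $\mathsf{KPS}$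 is the set of all formulas ($m\in\mathbb N$, $\phi_i,\chi_i$ classical) $$\mathsf{KPS}_m:\quad (\phi_0,\dots,\phi_m\,\mathtt{E}_{\mathsf G}\,\chi_0,\dots,\chi_m)\wedge\bigwedge_{i=0}^{m-1}\triangle(\mathtt{B}\phi_i\to_{\mathsf G}\mathtt{B}\chi_i)\ \to_{\mathsf G}\ \triangle(\mathtt{B}\chi_m\to_{\mathsf G}\mathtt{B}\phi_m),$$ where, with $M=\{0,\dots,m\}$, $\phi_0,\dots,\phi_m\,\mathtt{E}_{\mathsf G}\,\chi_0,\dots,\chi_m$ is $$\triangle\Big(\mathtt{B}\Big(\bigvee_{i=0}^{m+1}\bigvee_{\substack{K,L\subseteq M\\|K|=|L|=i}}\Big(\bigwedge_{k\in K}{\sim}\phi_k\wedge\bigwedge_{k\in M\setminus K}\phi_k\wedge\bigwedge_{l\in L}{\sim}\chi_l\wedge\bigwedge_{l\in M\setminus L}\chi_l\Big)\Big)\leftrightarrow_{\mathsf G}\mathtt{B}\top\Big).$$ **Calculus.** $\mathcal H\mathsf{QG}\oplus\mathsf{KPS}$ has as axioms all members of $\mathsf{KPS}$ and, for all classical $\phi,\chi$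 and two-layered $\alpha,\beta,\gamma$ (writing $\to,\prec,{\sim}$ for $\to_{\mathsf G},\prec_{\mathsf G},{\sim}_{\mathsf G}$): - ${\sim}\triangle(\mathtt{B}\phi\to\mathtt{B}\chi)$ if $\mathsf{CPL}\vdash\phi$ and $\mathsf{CPL}\vdash{\sim}\chi$; $\ \mathtt{B}\phi\to\mathtt{B}\chi$ if $\mathsf{CPL}\vdash\phi\supset\chi$; - $(\alpha\to\beta)\to((\beta\to\gamma)\to(\alpha\to\gamma))$; $\ \alpha\to(\alpha\vee\beta)$; $\ \beta\to(\alpha\vee\beta)$; $\ (\alpha\to\gamma)\to((\beta\to\gamma)\to((\alpha\vee\beta)\to\gamma))$; - $(\alpha\wedge\beta)\to\alpha$; $\ (\alpha\wedge\beta)\to\beta$; $\ (\alpha\to\beta)\to((\alpha\to\gamma)\to(\alpha\to(\beta\wedge\gamma)))$; - $(\alpha\to(\beta\to\gamma))\to((\alpha\wedge\beta)\to\gamma)$; $\ ((\alpha\wedge\beta)\to\gamma)\to(\alpha\to(\beta\to\gamma))$; $\ (\alpha\to\beta)\to({\sim}\beta\to{\sim}\alpha)$; - $(\alpha\prec\beta)\to(\top_{\mathsf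 G}\prec(\alpha\to\beta))$; $\ {\sim}(\alpha\prec\beta)\to(\alpha\to\beta)$; $\ \alpha\to(\beta\vee(\alpha\prec\beta))$; $\ ((\alpha\prec\beta)\prec\gamma)\to(\alpha\prec(\beta\vee\gamma))$; - $(\alpha\to\beta)\vee(\beta\to\alpha)$; $\ {\sim}((\alpha\prec\beta)\wedge(\beta\prec\alpha))$. Its rules are modus ponens and $\triangle$-necessitation (from $\vdash\alpha$ infer $\vdash\triangle\alpha$, for $\alpha$ proved without premises). $\Xi\vdash\alpha$ denotes derivability from premises $\Xi$, and $\vdash\alpha$ means $\varnothing\vdash\alpha$. **Theorem.** 1. For every frame $\mathbb F=\langle W,\mu\rangle$: $\mathbb F\models\alpha$ for all $\alpha\in\mathsf{KPS}$ if and only if $\mu$ satisfies the Kraft–Pratt–Seidenberg conditions. 2. $\mathcal H\mathsf{QG}\oplus\mathsf{KPS}$ is the logic of $\mathsf{QPG}$ frames: for every two-layered formula $\alpha$, $\vdash\alpha$ if and only if $\mathbb F\models\alpha$ for every $\mathsf{QPG}$ frame $\mathbb F$. Moreover, for every finite set $\Xi$ of two-layered formulas, $\Xi\vdash\alpha$ if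 and only if $\Xi\models_{\mathsf{QPG}}\alpha$. -/

import Mathlib

universe u

namespace QualProb

/-! ### Inner layer: classical propositional logic over `{∼, ∧}` -/

/-- Classical formulas; the propositional variables are indexed by `ℕ`. -/
inductive CPL : Type
  | var : ℕ → CPL
  | neg : CPL → CPL
  | and : CPL → CPL → CPL

namespace CPL

def or (φ χ : CPL) : CPL := neg (and (neg φ) (neg χ))

def imp (φ χ : CPL) : CPL := or (neg φ) χ

def top : CPL := imp (var 0) (var 0)

def bot : CPL := neg top

/-- Conjunction of a list; the empty conjunction is `⊤`. -/
def bigAnd (l : List CPL) : CPL := l.foldr and top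

/-- Disjunction of a list; the empty disjunction is `⊥`. -/
def bigOr (l : List CPL) : CPL := l.foldr or bot

/-- Conjunction of `f i` over `i ∈ s` (in some fixed order). -/
noncomputable def conjOver {ι : Type} (s : Finset ι) (f : ι → CPL) : CPL :=
  bigAnd (s.toList.map f)

/-- Disjunction of `f i` over `i ∈ s` (in some fixed order). -/
noncomputable def disjOver {ι : Type} (s : Finset ι) (f : ι → CPL) : CPL :=
  bigOr (s.toList.map f)

/-- Truth at a state `x` under a valuation `v : Prop → 2^W`. -/
def Sat {W : Type u} (v : ℕ → Set W) (x : W) : CPL → Prop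
  | var p => x ∈ v p
  | neg φ => ¬ Sat v x φ
  | and φ χ => Sat v x φ ∧ Sat v x χ

/-- The extension `‖φ‖` of a formula. -/
def ext {W : Type u} (v : ℕ → Set W) (φ : CPL) : Set W := {x | Sat v x φ}

/-- Truth of a formula under a two-valued assignment. -/
def Holds (a : ℕ → Prop) : CPL → Prop
  | var p => a p
  | neg φ => ¬ Holds a φ
  | and φ χ => Holds a φ ∧ Holds a χ

/-- `φ` is a theorem of classical propositional logic, i.e. a tautology. -/
def IsTheorem (φ : CPL) : Prop := ∀ a : ℕ → Prop, Holds a φ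

end CPL

/-! ### Outer layer: the two-layered language -/

/-- Two-layered formulas: atoms `B φ` with `φ` classical, combined by the
bi-Gödel connectives (`coimp α β` is the co-implication "`α` excludes `β`"). -/
inductive QG : Type
  | B : CPL → QG
  | and : QG → QG → QG
  | or : QG → QG → QG
  | imp : QG → QG → QG
  | coimp : QG → QG → QG

namespace QG

/-- `⊤_G`, of the form `α →_G α`. -/
def top : QG := imp (B (CPL.var 0)) (B (CPL.var 0))

/-- `⊥_G`, of the form `α` co-implies `α`. -/
def bot : QG := coimp (B (CPL.var 0)) (B (CPL.var 0))

/-- Gödel negation `∼_G α`. -/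
def neg (α : QG) : QG := imp α bot

/-- The operator `△`. -/
def delta (α : QG) : QG := imp (coimp top α) bot

def iff (α β : QG) : QG := and (imp α β) (imp β α)

/-- Conjunction of a list; the empty conjunction is `⊤_G`. -/
def bigAnd (l : List QG) : QG := l.foldr and top

end QG

/-! ### Semantics -/

/-- The Gödel implication on `[0,1]`. -/
noncomputable def gImp (a b : unitInterval) : unitInterval :=
  if a ≤ b then 1 else b

/-- The Gödel co-implication on `[0,1]`. -/
noncomputable def gCoimp (b a : unitInterval) : unitInterval :=
  if b ≤ a then 0 else b

/-- An uncertainty frame: a nonempty set with an uncertainty measure, i.e. a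
`[0,1]`-valued set function that is monotone and non-trivial. -/
structure Frame : Type (u + 1) where
  W : Type u
  nonempty : Nonempty W
  μ : Set W → unitInterval
  mono : ∀ X Y : Set W, X ⊆ Y → μ X ≤ μ Y
  nontriv : μ ∅ < μ Set.univ

namespace Frame

/-- The value of a two-layered formula in the model given by a frame and a
valuation of the propositional variables. -/
noncomputable def eval (F : Frame.{u}) (v : ℕ → Set F.W) : QG → unitInterval
  | QG.B φ => F.μ (CPL.ext v φ)
  | QG.and α β => min (F.eval v α) (F.eval v β)
  | QG.or α β => max (F.eval v α) (F.eval v β)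
  | QG.imp α β => gImp (F.eval v α) (F.eval v β)
  | QG.coimp α β => gCoimp (F.eval v α) (F.eval v β)

/-- `F ⊨ α`. -/
def Validates (F : Frame.{u}) (α : QG) : Prop :=
  ∀ v : ℕ → Set F.W, F.eval v α = 1

/-- The Kraft–Pratt–Seidenberg conditions for the measure of a frame. -/
def SatisfiesKPS (F : Frame.{u}) : Prop :=
  ∀ (m : ℕ) (X Y : Fin (m + 1) → Set F.W),
    (∀ j : Fin m, F.μ (X j.castSucc) ≤ F.μ (Y j.castSucc)) →
    (∀ w : F.W, Set.ncard {i | w ∈ X i} = Set.ncard {i | w ∈ Y i}) →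
    F.μ (Y (Fin.last m)) ≤ F.μ (X (Fin.last m))

end Frame

/-- A `QPG` frame is an uncertainty frame with the Kraft–Pratt–Seidenberg conditions. -/
def IsQPGFrame (F : Frame.{u}) : Prop := F.SatisfiesKPS

/-- Entailment over the class of `QPG` frames: in every model on such a frame the
infimum (in `[0,1]`) of the values of the premises is at most the value of the conclusion. -/
def EntailsQPG (Ξ : Set QG) (α : QG) : Prop :=
  ∀ F : Frame.{u}, IsQPGFrame F → ∀ v : ℕ → Set F.W,
    sInf (F.eval v '' Ξ) ≤ F.eval v α

/-! ### The Kraft–Pratt–Seidenberg axioms -/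

/-- The classical formula saying that as many of the `φ i` as of the `χ i` are false. -/
noncomputable def sameCount {n : ℕ} (φ χ : Fin n → CPL) : CPL :=
  CPL.disjOver (Finset.range (n + 1)) fun i =>
    CPL.disjOver (Finset.powersetCard i Finset.univ ×ˢ Finset.powersetCard i Finset.univ)
      fun KL : Finset (Fin n) × Finset (Fin n) =>
        CPL.and
          (CPL.and (CPL.conjOver KL.1 fun k => CPL.neg (φ k)) (CPL.conjOver KL.1ᶜ φ))
          (CPL.and (CPL.conjOver KL.2 fun l => CPL.neg (χ l)) (CPL.conjOver KL.2ᶜ χ))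

/-- `φ_1, …, φ_n E_G χ_1, …, χ_n`. -/
noncomputable def eG {n : ℕ} (φ χ : Fin n → CPL) : QG :=
  QG.delta (QG.iff (QG.B (sameCount φ χ)) (QG.B CPL.top))

/-- The instance of `KPS_m` for the formulas `φ_0, …, φ_m` and `χ_0, …, χ_m`. -/
noncomputable def kps (m : ℕ) (φ χ : Fin (m + 1) → CPL) : QG :=
  QG.imp
    (QG.and (eG φ χ)
      (QG.bigAnd ((List.finRange m).map fun i =>
        QG.delta (QG.imp (QG.B (φ i.castSucc)) (QG.B (χ i.castSucc))))))
    (QG.delta (QG.imp (QG.B (χ (Fin.last m))) (QG.B (φ (Fin.last m)))))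

/-- All instances of all `KPS_m`. -/
def KPS : Set QG := {α | ∃ (m : ℕ) (φ χ : Fin (m + 1) → CPL), α = kps m φ χ}

/-! ### The calculus -/

/-- The axioms of the Hilbert calculus for bi-Gödel logic, instantiated with
two-layered formulas. -/
inductive BiGAxiom : QG → Prop
  | trans (α β γ : QG) : BiGAxiom ((α.imp β).imp ((β.imp γ).imp (α.imp γ)))
  | orLeft (α β : QG) : BiGAxiom (α.imp (α.or β))
  | orRight (α β : QG) : BiGAxiom (β.imp (α.or β))
  | orElim (α β γ : QG) : BiGAxiom ((α.imp γ).imp ((β.imp γ).imp ((α.or β).imp γ)))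
  | andLeft (α β : QG) : BiGAxiom ((α.and β).imp α)
  | andRight (α β : QG) : BiGAxiom ((α.and β).imp β)
  | andIntro (α β γ : QG) : BiGAxiom ((α.imp β).imp ((α.imp γ).imp (α.imp (β.and γ))))
  | uncurry (α β γ : QG) : BiGAxiom ((α.imp (β.imp γ)).imp ((α.and β).imp γ))
  | curry (α β γ : QG) : BiGAxiom (((α.and β).imp γ).imp (α.imp (β.imp γ)))
  | contra (α β : QG) : BiGAxiom ((α.imp β).imp (β.neg.imp α.neg))
  | coimpTop (α β : QG) : BiGAxiom ((α.coimp β).imp (QG.top.coimp (α.imp β)))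
  | negCoimp (α β : QG) : BiGAxiom ((α.coimp β).neg.imp (α.imp β))
  | orCoimp (α β : QG) : BiGAxiom (α.imp (β.or (α.coimp β)))
  | coimpOr (α β γ : QG) : BiGAxiom (((α.coimp β).coimp γ).imp (α.coimp (β.or γ)))
  | prel (α β : QG) : BiGAxiom ((α.imp β).or (β.imp α))
  | coprel (α β : QG) : BiGAxiom ((α.coimp β).and (β.coimp α)).neg

/-- The axioms of `HQG`. -/
inductive HQGAxiom : QG → Prop
  | nontriv (φ χ : CPL) : φ.IsTheorem → χ.neg.IsTheorem →
      HQGAxiom (QG.delta ((QG.B φ).imp (QG.B χ))).neg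
  | reg (φ χ : CPL) : (φ.imp χ).IsTheorem → HQGAxiom ((QG.B φ).imp (QG.B χ))
  | biG (α : QG) : BiGAxiom α → HQGAxiom α

/-- `HQG` as a set of axioms. -/
def HQG : Set QG := {α | HQGAxiom α}

/-- Derivability of a formula from premises `Ξ` in the calculus with axioms `Ax`, modus
ponens, and `△`-necessitation; the latter applies to formulas proved without premises. -/
inductive Derives (Ax : Set QG) : Set QG → QG → Prop
  | ax {Ξ : Set QG} {α : QG} : α ∈ Ax → Derives Ax Ξ α
  | prem {Ξ : Set QG} {α : QG} : α ∈ Ξ → Derives Ax Ξ α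
  | mp {Ξ : Set QG} {α β : QG} : Derives Ax Ξ α → Derives Ax Ξ (α.imp β) → Derives Ax Ξ β
  | nec {Ξ : Set QG} {α : QG} : Derives Ax ∅ α → Derives Ax Ξ α.delta

end QualProb

/-!
The counting formula `E` of an axiom `KPS_m` holds exactly where the two sequences of extensions
cover a state equally often, so validity of the axioms is the Kraft–Pratt–Seidenberg condition with
counting only required on a set of full measure. This is no stronger: the case `m = 1` already gives
the complement of such a set measure `μ(∅)` and makes traces on the set as large as the sets
themselves. Fresh variables as atoms give the converse.

For completeness, a formula that is not derivable is avoided by a prime theory closed under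
`△`-necessitation. Its Lindenbaum algebra is a countable chain, hence embeds in `[0,1]`, and the
connectives are determined by the order. On the truth assignments to the finitely many variables
of the formula every set is definable, so the values of the atoms `B φ` define a measure on all
sets, and the axioms in the theory make it a Kraft–Pratt–Seidenberg measure. Premises are handled by
adding their conjunction as an antecedent, since entailment compares values.
-/

namespace QualProb

theorem one_le_iff_eq_one {a : unitInterval} : 1 ≤ a ↔ a = 1 := top_le_iff

theorem gImp_eq_one_iff {a b : unitInterval} : gImp a b = 1 ↔ a ≤ b := by
  unfold gImp
  split_ifs with h
  · exact iff_of_true rfl h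
  · exact iff_of_false (fun hb => h (hb ▸ unitInterval.le_one')) h

theorem le_gImp_iff {a b c : unitInterval} : c ≤ gImp a b ↔ min c a ≤ b := by
  unfold gImp
  split_ifs with h
  · exact iff_of_true unitInterval.le_one' (min_le_of_right_le h)
  · simp only [min_le_iff, h, or_false]

theorem gCoimp_le_iff {a b c : unitInterval} : gCoimp a b ≤ c ↔ a ≤ max b c := by
  unfold gCoimp
  split_ifs with h
  · exact iff_of_true unitInterval.nonneg' (le_max_of_le_left h)
  · simp only [le_max_iff, h, false_or]

namespace Frame

section Eval

variable (F : Frame.{u}) (v : ℕ → Set F.W) (α β : QG)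

@[simp] theorem eval_B (φ : CPL) : F.eval v (.B φ) = F.μ (CPL.ext v φ) := rfl

@[simp] theorem eval_and : F.eval v (.and α β) = min (F.eval v α) (F.eval v β) := rfl

@[simp] theorem eval_or : F.eval v (.or α β) = max (F.eval v α) (F.eval v β) := rfl

@[simp] theorem eval_imp : F.eval v (.imp α β) = gImp (F.eval v α) (F.eval v β) := rfl

@[simp] theorem eval_coimp : F.eval v (.coimp α β) = gCoimp (F.eval v α) (F.eval v β) := rfl

@[simp] theorem eval_top : F.eval v .top = 1 := gImp_eq_one_iff.2 le_rfl

@[simp] theorem eval_bot : F.eval v .bot = 0 := if_pos le_rfl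

@[simp] theorem eval_neg : F.eval v α.neg = if F.eval v α = 0 then 1 else 0 := by
  simp only [QG.neg, eval_imp, eval_bot, gImp, nonpos_iff_eq_zero]

@[simp] theorem eval_delta : F.eval v α.delta = if F.eval v α = 1 then 1 else 0 := by
  by_cases h : F.eval v α = 1 <;> simp [QG.delta, gImp, gCoimp, one_le_iff_eq_one, h]

end Eval

variable {F : Frame.{u}} {v : ℕ → Set F.W} {α β : QG}

theorem eval_imp_eq_one : F.eval v (.imp α β) = 1 ↔ F.eval v α ≤ F.eval v β := gImp_eq_one_iff

theorem eval_and_eq_one : F.eval v (.and α β) = 1 ↔ F.eval v α = 1 ∧ F.eval v β = 1 :=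
  min_eq_top

theorem eval_iff_eq_one : F.eval v (.iff α β) = 1 ↔ F.eval v α = F.eval v β := by
  rw [QG.iff, eval_and_eq_one, eval_imp_eq_one, eval_imp_eq_one, le_antisymm_iff]

theorem eval_delta_eq_one : F.eval v α.delta = 1 ↔ F.eval v α = 1 := by simp

theorem eval_imp_eq_one_of_eq_zero_or_eq_one (h : F.eval v α = 0 ∨ F.eval v α = 1) :
    F.eval v (.imp α β) = 1 ↔ (F.eval v α = 1 → F.eval v β = 1) := by
  rw [eval_imp_eq_one]
  rcases h with h | h
  · simp [h]
  · simp [h, one_le_iff_eq_one]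

theorem le_eval_bigAnd {c : unitInterval} {l : List QG} :
    c ≤ F.eval v (QG.bigAnd l) ↔ ∀ γ ∈ l, c ≤ F.eval v γ := by
  induction l with
  | nil => simpa [QG.bigAnd] using unitInterval.le_one'
  | cons γ l ih =>
    rw [List.forall_mem_cons, ← ih]
    exact le_min_iff

theorem eval_bigAnd_eq_one {l : List QG} :
    F.eval v (QG.bigAnd l) = 1 ↔ ∀ γ ∈ l, F.eval v γ = 1 := by
  simp only [← one_le_iff_eq_one, le_eval_bigAnd]

theorem eval_delta_eq_zero_or_eq_one (v : ℕ → Set F.W) (α : QG) :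
    F.eval v α.delta = 0 ∨ F.eval v α.delta = 1 := by
  rw [eval_delta]
  split_ifs <;> simp

theorem eval_and_eq_zero_or_eq_one (hα : F.eval v α = 0 ∨ F.eval v α = 1)
    (hβ : F.eval v β = 0 ∨ F.eval v β = 1) :
    F.eval v (.and α β) = 0 ∨ F.eval v (.and α β) = 1 := by
  rcases hα with hα | hα <;> rcases hβ with hβ | hβ <;> simp [hα, hβ]

theorem eval_bigAnd_eq_zero_or_eq_one {l : List QG}
    (hl : ∀ γ ∈ l, F.eval v γ = 0 ∨ F.eval v γ = 1) :
    F.eval v (QG.bigAnd l) = 0 ∨ F.eval v (QG.bigAnd l) = 1 := by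
  induction l with
  | nil => exact .inr (F.eval_top v)
  | cons γ l ih =>
    rw [List.forall_mem_cons] at hl
    exact eval_and_eq_zero_or_eq_one hl.1 (ih hl.2)

end Frame

/-! ### Classical formulas -/

namespace CPL

section Holds

variable (a : ℕ → Prop) (φ χ : CPL)

@[simp] theorem holds_neg : Holds a (.neg φ) ↔ ¬ Holds a φ := Iff.rfl

@[simp] theorem holds_and : Holds a (.and φ χ) ↔ Holds a φ ∧ Holds a χ := Iff.rfl

@[simp] theorem holds_or : Holds a (.or φ χ) ↔ Holds a φ ∨ Holds a χ := by
  simp only [or, holds_neg, holds_and]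
  tauto

@[simp] theorem holds_imp : Holds a (.imp φ χ) ↔ (Holds a φ → Holds a χ) := by
  simp only [imp, holds_neg, holds_or]
  tauto

@[simp] theorem holds_top : Holds a .top := by simp [top]

@[simp] theorem holds_bot : ¬ Holds a .bot := by simp [bot]

theorem holds_bigAnd (l : List CPL) : Holds a (bigAnd l) ↔ ∀ φ ∈ l, Holds a φ := by
  induction l with
  | nil => simp [bigAnd]
  | cons φ l ih => simp_all [bigAnd]

theorem holds_bigOr (l : List CPL) : Holds a (bigOr l) ↔ ∃ φ ∈ l, Holds a φ := by
  induction l with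
  | nil => simp [bigOr]
  | cons φ l ih => simp_all [bigOr]

theorem holds_conjOver {ι : Type} (s : Finset ι) (f : ι → CPL) :
    Holds a (conjOver s f) ↔ ∀ i ∈ s, Holds a (f i) := by
  simp [conjOver, holds_bigAnd]

theorem holds_disjOver {ι : Type} (s : Finset ι) (f : ι → CPL) :
    Holds a (disjOver s f) ↔ ∃ i ∈ s, Holds a (f i) := by
  simp [disjOver, holds_bigOr]

theorem holds_conjOver_neg_and_conjOver_compl {ι : Type} [Fintype ι] [DecidableEq ι]
    (f : ι → CPL) [DecidablePred fun i => Holds a (f i)] (K : Finset ι) :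
    Holds a (conjOver K fun k => (f k).neg) ∧ Holds a (conjOver Kᶜ f) ↔
      K = ({i | ¬ Holds a (f i)} : Finset ι) := by
  simp only [holds_conjOver, holds_neg, Finset.mem_compl, Finset.ext_iff, Finset.mem_filter_univ]
  grind

theorem holds_sameCount {n : ℕ} (φ χ : Fin n → CPL) :
    Holds a (sameCount φ χ) ↔
      Set.ncard {i | Holds a (φ i)} = Set.ncard {i | Holds a (χ i)} := by
  classical
  have ncard_add (ψ : Fin n → CPL) : Set.ncard {i | Holds a (ψ i)} +
      ({i | ¬ Holds a (ψ i)} : Finset (Fin n)).card = n := by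
    rw [Set.ncard_eq_toFinset_card', Set.toFinset_ofPred,
      Finset.card_filter_add_card_filter_not, Finset.card_fin]
  have holds_iff : Holds a (sameCount φ χ) ↔ ({i | ¬ Holds a (φ i)} : Finset (Fin n)).card =
      ({i | ¬ Holds a (χ i)} : Finset (Fin n)).card := by
    simp only [sameCount, holds_disjOver, holds_and, holds_conjOver_neg_and_conjOver_compl]
    have card_lt (K : Finset (Fin n)) : K.card < n + 1 := by
      simpa [Nat.lt_succ_iff] using K.card_le_univ
    simp [Nat.lt_succ_iff.1 (card_lt _), eq_comm]
  have hφ := ncard_add φ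
  have hχ := ncard_add χ
  rw [holds_iff]
  omega

end Holds

theorem sat_iff_holds {W : Type u} (v : ℕ → Set W) (x : W) (φ : CPL) :
    Sat v x φ ↔ Holds (fun p => x ∈ v p) φ := by
  induction φ with
  | var p => exact Iff.rfl
  | neg φ ih => exact not_congr ih
  | and φ χ ihφ ihχ => exact and_congr ihφ ihχ

section Ext

variable {W : Type u} (v : ℕ → Set W) {φ χ : CPL}

theorem mem_ext {x : W} : x ∈ ext v φ ↔ Holds (fun p => x ∈ v p) φ := sat_iff_holds v x φ

theorem ext_eq_univ_of_isTheorem (h : φ.IsTheorem) : ext v φ = Set.univ :=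
  Set.eq_univ_of_forall fun _ => (mem_ext v).2 (h _)

theorem ext_eq_empty_of_isTheorem_neg (h : φ.neg.IsTheorem) : ext v φ = ∅ :=
  Set.eq_empty_of_forall_notMem fun _ hx => h _ ((mem_ext v).1 hx)

theorem ext_subset_ext_of_isTheorem_imp (h : (φ.imp χ).IsTheorem) : ext v φ ⊆ ext v χ :=
  fun _ hx => (mem_ext v).2 ((holds_imp _ _ _).1 (h _) ((mem_ext v).1 hx))

theorem ext_top : ext v top = Set.univ := ext_eq_univ_of_isTheorem v holds_top

theorem ext_sameCount {n : ℕ} (φ χ : Fin n → CPL) :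
    ext v (sameCount φ χ) =
      {x | Set.ncard {i | x ∈ ext v (φ i)} = Set.ncard {i | x ∈ ext v (χ i)}} := by
  ext x
  simp only [mem_ext, holds_sameCount, Set.mem_ofPred_eq]

end Ext

end CPL

/-! ### Correspondence -/

namespace Frame

variable {F : Frame.{u}}

theorem eval_eG_eq_one {v : ℕ → Set F.W} {n : ℕ} {φ χ : Fin n → CPL} :
    F.eval v (eG φ χ) = 1 ↔
      F.μ {w | Set.ncard {i | w ∈ CPL.ext v (φ i)} = Set.ncard {i | w ∈ CPL.ext v (χ i)}} =
        F.μ Set.univ := by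
  rw [eG, eval_delta_eq_one, eval_iff_eq_one, eval_B, eval_B, CPL.ext_sameCount, CPL.ext_top]

theorem eval_kps_eq_one {v : ℕ → Set F.W} {m : ℕ} {φ χ : Fin (m + 1) → CPL} :
    F.eval v (kps m φ χ) = 1 ↔
      (F.μ {w | Set.ncard {i | w ∈ CPL.ext v (φ i)} = Set.ncard {i | w ∈ CPL.ext v (χ i)}} =
          F.μ Set.univ →
        (∀ i : Fin m, F.μ (CPL.ext v (φ i.castSucc)) ≤ F.μ (CPL.ext v (χ i.castSucc))) →
        F.μ (CPL.ext v (χ (Fin.last m))) ≤ F.μ (CPL.ext v (φ (Fin.last m)))) := by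
  rw [kps, eval_imp_eq_one_of_eq_zero_or_eq_one, eval_and_eq_one, eval_eG_eq_one,
    eval_bigAnd_eq_one]
  · simp only [List.forall_mem_map, List.mem_finRange, true_imp_iff, eval_delta_eq_one,
      eval_imp_eq_one, eval_B, and_imp]
  · refine eval_and_eq_zero_or_eq_one (eval_delta_eq_zero_or_eq_one v _)
      (eval_bigAnd_eq_zero_or_eq_one ?_)
    simp only [List.forall_mem_map, eval_delta_eq_zero_or_eq_one, implies_true]

theorem SatisfiesKPS.le_of_union_eq_of_inter_eq (hF : F.SatisfiesKPS) {X X' Y Y' : Set F.W}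
    (hunion : X ∪ X' = Y ∪ Y') (hinter : X ∩ X' = Y ∩ Y') (hle : F.μ X ≤ F.μ Y) :
    F.μ Y' ≤ F.μ X' := by
  classical
  have ncard_pair (A B : Set F.W) (w : F.W) :
      Set.ncard {i | w ∈ ![A, B] i} = (if w ∈ A then 1 else 0) + if w ∈ B then 1 else 0 := by
    rw [Set.ncard_eq_toFinset_card', Set.toFinset_ofPred, Finset.card_filter, Fin.sum_univ_two]
    rfl
  refine hF 1 ![X, X'] ![Y, Y'] (Fin.forall_fin_one.2 hle) fun w => ?_
  have mem_union := Set.ext_iff.1 hunion w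
  have mem_inter := Set.ext_iff.1 hinter w
  rw [ncard_pair, ncard_pair]
  grind

theorem SatisfiesKPS.measure_le_measure_inter (hF : F.SatisfiesKPS) {D : Set F.W}
    (hD : F.μ D = F.μ Set.univ) (X : Set F.W) : F.μ X ≤ F.μ (X ∩ D) := by
  have compl_null : F.μ Dᶜ ≤ F.μ ∅ :=
    hF.le_of_union_eq_of_inter_eq (by simp) (by simp) hD.ge
  refine hF.le_of_union_eq_of_inter_eq (X := X \ D) (Y := ∅) ?_ ?_
    ((F.mono _ _ fun _ hw => hw.2).trans compl_null)
  · rw [Set.union_comm, Set.inter_union_sdiff, Set.empty_union]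
  · grind

theorem SatisfiesKPS.validates_kps (hF : F.SatisfiesKPS) {α : QG} (hα : α ∈ KPS) :
    F.Validates α := by
  obtain ⟨m, φ, χ, rfl⟩ := hα
  intro v
  rw [eval_kps_eq_one]
  intro hD hle
  set D := {w | Set.ncard {i | w ∈ CPL.ext v (φ i)} = Set.ncard {i | w ∈ CPL.ext v (χ i)}}
  have inter_le (X : Set F.W) : F.μ (X ∩ D) ≤ F.μ X := F.mono _ _ Set.inter_subset_left
  have le_inter := hF.measure_le_measure_inter hD
  -- Outside `D` none of the traces on `D` count, so the traces satisfy the counting condition.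
  have kps_on_D : F.μ (CPL.ext v (χ (Fin.last m)) ∩ D) ≤ F.μ (CPL.ext v (φ (Fin.last m)) ∩ D) := by
    refine hF m (fun i => CPL.ext v (φ i) ∩ D) (fun i => CPL.ext v (χ i) ∩ D)
      (fun j => (inter_le _).trans ((hle j).trans (le_inter _))) fun w => ?_
    by_cases hw : w ∈ D
    · simp only [Set.mem_inter_iff, hw, and_true]
      exact hw
    · simp only [Set.mem_inter_iff, hw, and_false]
  exact (le_inter _).trans (kps_on_D.trans (inter_le _))

theorem satisfiesKPS_of_validates_kps (h : ∀ α ∈ KPS, F.Validates α) : F.SatisfiesKPS := by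
  intro m X Y hle hcount
  let code : Fin (m + 1) ⊕ Fin (m + 1) → ℕ := Encodable.encode
  let v : ℕ → Set F.W := Function.extend code (Sum.elim X Y) fun _ => ∅
  have ext_code (i) : CPL.ext v (.var (code i)) = Sum.elim X Y i :=
    Encodable.encode_injective.extend_apply (Sum.elim X Y) (fun _ => ∅) i
  have hkps := h _ ⟨m, fun i => .var (code (.inl i)), fun i => .var (code (.inr i)), rfl⟩ v
  simp only [eval_kps_eq_one, ext_code, Sum.elim_inl, Sum.elim_inr] at hkps
  exact hkps (congrArg F.μ (Set.eq_univ_of_forall hcount)) hle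

theorem validates_kps_iff_satisfiesKPS : (∀ α ∈ KPS, F.Validates α) ↔ F.SatisfiesKPS :=
  ⟨satisfiesKPS_of_validates_kps, fun hF _ hα => hF.validates_kps hα⟩

end Frame

/-! ### Soundness -/

theorem BiGAxiom.validates {α : QG} (h : BiGAxiom α) (F : Frame.{u}) : F.Validates α := by
  intro v
  have zero_le (β : QG) : 0 ≤ F.eval v β := unitInterval.nonneg'
  have le_one (β : QG) : F.eval v β ≤ 1 := unitInterval.le_one'
  have zero_lt_one : (0 : unitInterval) < 1 := zero_lt_one
  cases h <;>
    simp only [Frame.eval_imp, Frame.eval_and, Frame.eval_or, Frame.eval_coimp, Frame.eval_neg,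
      Frame.eval_top, gImp, gCoimp] <;>
    grind

theorem HQGAxiom.validates {α : QG} (h : HQGAxiom α) (F : Frame.{u}) : F.Validates α := by
  intro v
  cases h with
  | nontriv φ χ hφ hχ =>
    have eval_ne_one : F.eval v ((QG.B φ).imp (QG.B χ)) ≠ 1 := by
      rw [Ne, Frame.eval_imp_eq_one, Frame.eval_B, Frame.eval_B, CPL.ext_eq_univ_of_isTheorem v hφ,
        CPL.ext_eq_empty_of_isTheorem_neg v hχ, not_le]
      exact F.nontriv
    rw [Frame.eval_neg, Frame.eval_delta, if_neg eval_ne_one, if_pos rfl]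
  | reg φ χ h =>
    exact Frame.eval_imp_eq_one.2 (F.mono _ _ (CPL.ext_subset_ext_of_isTheorem_imp v h))
  | biG α h => exact h.validates F v

theorem Derives.sInf_le_eval {Ax Ξ : Set QG} {α : QG} (h : Derives Ax Ξ α) {F : Frame.{u}}
    (hF : ∀ β ∈ Ax, F.Validates β) (v : ℕ → Set F.W) : sInf (F.eval v '' Ξ) ≤ F.eval v α := by
  induction h with
  | ax h => exact unitInterval.le_one'.trans_eq (hF _ h v).symm
  | prem h => exact sInf_le (Set.mem_image_of_mem _ h)
  | mp _ _ ih ih' => exact (le_min le_rfl ih).trans (le_gImp_iff.1 ih')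
  | nec _ ih =>
    rw [Set.image_empty, sInf_empty] at ih
    exact unitInterval.le_one'.trans_eq (Frame.eval_delta_eq_one.2 (top_le_iff.1 ih)).symm

theorem Derives.validates {Ax : Set QG} {α : QG} (h : Derives Ax ∅ α) {F : Frame.{u}}
    (hF : ∀ β ∈ Ax, F.Validates β) : F.Validates α := by
  intro v
  have le_eval := h.sInf_le_eval hF v
  rw [Set.image_empty, sInf_empty] at le_eval
  exact top_le_iff.1 le_eval

theorem Frame.SatisfiesKPS.validates_axiom {F : Frame.{u}} (hF : F.SatisfiesKPS) :
    ∀ α ∈ HQG ∪ KPS, F.Validates α := by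
  rintro α (h | h)
  · exact HQGAxiom.validates h F
  · exact hF.validates_kps h

/-! ### Theories of bi-Gödel logic -/

/-- A set of two-layered formulas containing the bi-Gödel axioms and closed under modus ponens and
`△`-necessitation. -/
structure IsTheory (T : Set QG) : Prop where
  ax {α : QG} : BiGAxiom α → α ∈ T
  mp {α β : QG} : α ∈ T → α.imp β ∈ T → β ∈ T
  nec {α : QG} : α ∈ T → α.delta ∈ T

theorem isTheory_derives {Ax : Set QG} (hAx : ∀ α, BiGAxiom α → α ∈ Ax) :
    IsTheory {α | Derives Ax ∅ α} where
  ax h := .ax (hAx _ h)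
  mp h h' := .mp h h'
  nec h := .nec h

namespace IsTheory

variable {T : Set QG} {α β γ δ : QG}

section Calculus

variable (hT : IsTheory T)
include hT

theorem and_left (α β : QG) : (α.and β).imp α ∈ T := hT.ax (.andLeft _ _)

theorem and_right (α β : QG) : (α.and β).imp β ∈ T := hT.ax (.andRight _ _)

theorem or_left (α β : QG) : α.imp (α.or β) ∈ T := hT.ax (.orLeft _ _)

theorem or_right (α β : QG) : β.imp (α.or β) ∈ T := hT.ax (.orRight _ _)

theorem imp_or_coimp (α β : QG) : α.imp (β.or (α.coimp β)) ∈ T := hT.ax (.orCoimp _ _)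

theorem imp_trans (h : α.imp β ∈ T) (h' : β.imp γ ∈ T) : α.imp γ ∈ T :=
  hT.mp h' (hT.mp h (hT.ax (.trans _ _ _)))

theorem curry (h : (α.and β).imp γ ∈ T) : α.imp (β.imp γ) ∈ T := hT.mp h (hT.ax (.curry _ _ _))

theorem uncurry (h : α.imp (β.imp γ) ∈ T) : (α.and β).imp γ ∈ T :=
  hT.mp h (hT.ax (.uncurry _ _ _))

theorem imp_imp_left (α β : QG) : α.imp (β.imp α) ∈ T := hT.curry (hT.and_left _ _)

theorem imp_of_mem (h : β ∈ T) : α.imp β ∈ T := hT.mp h (hT.imp_imp_left _ _)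

theorem imp_refl (α : QG) : α.imp α ∈ T :=
  hT.mp (hT.imp_imp_left α α) (hT.curry (hT.and_right _ _))

theorem top_mem : QG.top ∈ T := hT.imp_refl _

theorem imp_and (h : α.imp β ∈ T) (h' : α.imp γ ∈ T) : α.imp (β.and γ) ∈ T :=
  hT.mp h' (hT.mp h (hT.ax (.andIntro _ _ _)))

theorem or_imp (h : α.imp γ ∈ T) (h' : β.imp γ ∈ T) : (α.or β).imp γ ∈ T :=
  hT.mp h' (hT.mp h (hT.ax (.orElim _ _ _)))

theorem imp_mp (h : α.imp (β.imp γ) ∈ T) (h' : α.imp β ∈ T) : α.imp γ ∈ T :=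
  hT.imp_trans (hT.imp_and (hT.imp_refl _) h') (hT.uncurry h)

theorem imp_imp_and (α β : QG) : α.imp (β.imp (α.and β)) ∈ T := hT.curry (hT.imp_refl _)

theorem and_mem (h : α ∈ T) (h' : β ∈ T) : α.and β ∈ T := hT.mp h' (hT.mp h (hT.imp_imp_and _ _))

theorem bigAnd_mem {l : List QG} (h : ∀ γ ∈ l, γ ∈ T) : QG.bigAnd l ∈ T := by
  induction l with
  | nil => exact hT.top_mem
  | cons γ l ih =>
    rw [List.forall_mem_cons] at h
    exact hT.and_mem h.1 (ih h.2)

theorem or_mem_of_imp (h : α.or β ∈ T) (hα : α.imp γ ∈ T) (hβ : β.imp δ ∈ T) : γ.or δ ∈ T :=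
  hT.mp h (hT.or_imp (hT.imp_trans hα (hT.or_left _ _)) (hT.imp_trans hβ (hT.or_right _ _)))

theorem neg_imp_neg (h : α.imp β ∈ T) : β.neg.imp α.neg ∈ T := hT.mp h (hT.ax (.contra _ _))

theorem coimp_imp_of_imp_or (h : α.imp (β.or γ) ∈ T) : (α.coimp β).imp γ ∈ T := by
  have coimp_or_imp_bot : (α.coimp (β.or γ)).imp QG.bot ∈ T :=
    hT.imp_trans (hT.ax (.coimpTop _ _)) (hT.nec h)
  have neg_coimp_coimp : ((α.coimp β).coimp γ).neg ∈ T :=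
    hT.imp_trans (hT.ax (.coimpOr _ _ _)) coimp_or_imp_bot
  exact hT.mp neg_coimp_coimp (hT.ax (.negCoimp _ _))

theorem bot_imp (α : QG) : QG.bot.imp α ∈ T := hT.coimp_imp_of_imp_or (hT.or_left _ _)

theorem delta_imp (α : QG) : α.delta.imp α ∈ T :=
  hT.imp_mp (hT.ax (.negCoimp _ _)) (hT.imp_of_mem hT.top_mem)

theorem delta_imp_delta (h : α.imp β ∈ T) : α.delta.imp β.delta ∈ T :=
  hT.neg_imp_neg <| hT.coimp_imp_of_imp_or <| hT.imp_trans (hT.imp_or_coimp QG.top α) <|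
    hT.or_imp (hT.imp_trans h (hT.or_left _ _)) (hT.or_right _ _)

theorem neg_or_neg_of_neg_and (h : (α.and β).neg ∈ T) : α.neg.or β.neg ∈ T := by
  refine hT.or_mem_of_imp (hT.ax (.prel α β)) (hT.curry ?_) (hT.curry ?_)
  · exact hT.imp_trans (hT.imp_and (hT.and_right _ _)
      (hT.imp_mp (hT.and_left _ _) (hT.and_right _ _))) h
  · exact hT.imp_trans (hT.imp_and (hT.imp_mp (hT.and_left _ _) (hT.and_right _ _))
      (hT.and_right _ _)) h

theorem neg_or_neg_neg (α : QG) : α.neg.or α.neg.neg ∈ T :=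
  hT.neg_or_neg_of_neg_and (hT.imp_mp (hT.and_right _ _) (hT.and_left _ _))

theorem delta_or_delta (h : α.or β ∈ T) : α.delta.or β.delta ∈ T := by
  have left : (QG.top.coimp α).imp (β.coimp α) ∈ T :=
    hT.coimp_imp_of_imp_or (hT.imp_of_mem
      (hT.mp h (hT.or_imp (hT.or_left _ _) (hT.imp_or_coimp _ _))))
  have right : (QG.top.coimp β).imp (α.coimp β) ∈ T :=
    hT.coimp_imp_of_imp_or (hT.imp_of_mem
      (hT.mp h (hT.or_imp (hT.imp_or_coimp _ _) (hT.or_left _ _))))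
  have neg_coimp_and_coimp : ((QG.top.coimp α).and (QG.top.coimp β)).neg ∈ T :=
    hT.imp_trans (hT.imp_and (hT.imp_trans (hT.and_left _ _) left)
      (hT.imp_trans (hT.and_right _ _) right)) (hT.ax (.coprel _ _))
  exact hT.neg_or_neg_of_neg_and neg_coimp_and_coimp

theorem delta_imp_delta_delta (α : QG) : α.delta.imp α.delta.delta ∈ T := by
  have delta_delta_or_neg : α.delta.delta.or α.delta.neg ∈ T :=
    hT.or_mem_of_imp (hT.delta_or_delta (hT.neg_or_neg_neg (QG.top.coimp α))) (hT.imp_refl _)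
      (hT.delta_imp _)
  refine hT.mp delta_delta_or_neg (hT.or_imp (hT.imp_imp_left _ _) (hT.curry ?_))
  exact hT.imp_trans (hT.imp_mp (hT.and_left _ _) (hT.and_right _ _)) (hT.bot_imp _)

end Calculus

/-! ### Prime theories -/

theorem adjoin (hT : IsTheory T) (α : QG) : IsTheory {β | α.delta.imp β ∈ T} where
  ax h := hT.imp_of_mem (hT.ax h)
  mp h h' := hT.imp_mp h' h
  nec h := hT.imp_trans (hT.delta_imp_delta_delta α) (hT.delta_imp_delta h)

theorem sUnion {c : Set (Set QG)} (hc : ∀ S ∈ c, IsTheory S) (hdir : DirectedOn (· ⊆ ·) c)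
    (hne : c.Nonempty) : IsTheory (⋃₀ c) where
  ax h := hne.elim fun S hS => ⟨S, hS, (hc S hS).ax h⟩
  mp := by
    rintro α β ⟨S, hS, hα⟩ ⟨S', hS', himp⟩
    obtain ⟨U, hU, hSU, hSU'⟩ := hdir S hS S' hS'
    exact ⟨U, hU, (hc U hU).mp (hSU hα) (hSU' himp)⟩
  nec := by
    rintro α ⟨S, hS, hα⟩
    exact ⟨S, hS, (hc S hS).nec hα⟩

theorem exists_maximal_notMem (hT : IsTheory T) (hα : α ∉ T) :
    ∃ P, T ⊆ P ∧ Maximal (fun S => IsTheory S ∧ α ∉ S) P := by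
  refine zorn_subset_nonempty {S | IsTheory S ∧ α ∉ S} (fun c hc hchain hne => ?_) T ⟨hT, hα⟩
  refine ⟨⋃₀ c, ⟨sUnion (fun S hS => (hc hS).1) hchain.directedOn hne, ?_⟩,
    fun S => Set.subset_sUnion_of_mem⟩
  rintro ⟨S, hS, hαS⟩
  exact (hc hS).2 hαS

end IsTheory

/-- A consistent theory with the disjunction property; by prelinearity, its Lindenbaum algebra is a
nontrivial chain. -/
structure IsPrimeTheory (P : Set QG) : Prop extends IsTheory P where
  bot_notMem : QG.bot ∉ P
  mem_or_mem {α β : QG} : α.or β ∈ P → α ∈ P ∨ β ∈ P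

theorem isPrimeTheory_of_maximal_notMem {P : Set QG} {α : QG}
    (hP : Maximal (fun S => IsTheory S ∧ α ∉ S) P) : IsPrimeTheory P := by
  obtain ⟨hPT, hα⟩ := hP.prop
  have delta_imp_mem {β : QG} (hβ : β ∉ P) : β.delta.imp α ∈ P := by
    by_contra hcon
    exact hβ (hP.le_of_ge ⟨hPT.adjoin β, hcon⟩ (fun γ hγ => hPT.imp_of_mem hγ) (hPT.delta_imp β))
  refine { hPT with
    bot_notMem := fun hbot => hα (hPT.mp hbot (hPT.bot_imp α))
    mem_or_mem := fun {β γ} hor => ?_ }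
  by_contra! hcon
  exact hα (hPT.mp (hPT.delta_or_delta hor)
    (hPT.or_imp (delta_imp_mem hcon.1) (delta_imp_mem hcon.2)))

theorem IsTheory.exists_isPrimeTheory_notMem {T : Set QG} {α : QG} (hT : IsTheory T)
    (hα : α ∉ T) : ∃ P, T ⊆ P ∧ IsPrimeTheory P ∧ α ∉ P := by
  obtain ⟨P, hTP, hP⟩ := hT.exists_maximal_notMem hα
  exact ⟨P, hTP, isPrimeTheory_of_maximal_notMem hP, hP.prop.2⟩

/-! ### The chain of a prime theory -/

/-- An injective coding of classical formulas by natural numbers. -/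
def CPL.code : CPL → ℕ
  | var p => Nat.pair 0 p
  | neg φ => Nat.pair 1 φ.code
  | and φ χ => Nat.pair 2 (Nat.pair φ.code χ.code)

theorem CPL.code_injective : Function.Injective CPL.code := by
  intro φ χ h
  induction φ generalizing χ <;> cases χ <;> grind [CPL.code, Nat.pair_eq_pair]

/-- An injective coding of two-layered formulas by natural numbers. -/
def QG.code : QG → ℕ
  | B φ => Nat.pair 0 φ.code
  | and α β => Nat.pair 1 (Nat.pair α.code β.code)
  | or α β => Nat.pair 2 (Nat.pair α.code β.code)
  | imp α β => Nat.pair 3 (Nat.pair α.code β.code)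
  | coimp α β => Nat.pair 4 (Nat.pair α.code β.code)

theorem QG.code_injective : Function.Injective QG.code := by
  intro α β h
  induction α generalizing β <;> cases β <;>
    grind [QG.code, Nat.pair_eq_pair, CPL.code_injective.eq_iff]

instance : Countable QG := QG.code_injective.countable

theorem exists_unitInterval_le_iff_le {A : Type*} [Preorder A] [Std.Total (α := A) (· ≤ ·)]
    [BoundedOrder A] [Countable A] (h : ¬ (⊤ : A) ≤ ⊥) :
    ∃ g : A → unitInterval, (∀ x y, g x ≤ g y ↔ x ≤ y) ∧ g ⊥ = 0 ∧ g ⊤ = 1 := by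
  classical
  have : Countable (Antisymmetrization A (· ≤ ·)) := Quotient.countable
  obtain ⟨f⟩ := Order.embedding_from_countable_to_dense (Antisymmetrization A (· ≤ ·)) ℝ
  let k (x : A) : ℝ := f (toAntisymmetrization (· ≤ ·) x)
  have k_le_iff (x y : A) : k x ≤ k y ↔ x ≤ y := by
    simp only [k, f.le_iff_le, toAntisymmetrization_le_toAntisymmetrization_iff]
  have length_pos : 0 < k ⊤ - k ⊥ := sub_pos.2 (not_le.1 fun hk => h ((k_le_iff _ _).1 hk))
  have ratio_mem (x : A) : (k x - k ⊥) / (k ⊤ - k ⊥) ∈ unitInterval :=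
    unitInterval.div_mem (sub_nonneg.2 ((k_le_iff _ _).2 bot_le)) length_pos.le
      (sub_le_sub_right ((k_le_iff _ _).2 le_top) _)
  refine ⟨fun x => ⟨_, ratio_mem x⟩, fun x y => Subtype.mk_le_mk.trans ?_, ?_, ?_⟩
  · rw [div_le_div_iff_of_pos_right length_pos, sub_le_sub_iff_right, k_le_iff]
  · ext; simp
  · ext; simp [length_pos.ne']

/-- `g` represents in `[0,1]` the order of the Lindenbaum algebra of `P`, in which `α` is below `β`
when `α →_G β` belongs to `P`. -/
structure Represents (P : Set QG) (g : QG → unitInterval) : Prop where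
  le_iff (α β : QG) : g α ≤ g β ↔ α.imp β ∈ P
  map_bot : g QG.bot = 0
  map_top : g QG.top = 1

theorem IsPrimeTheory.exists_represents {P : Set QG} (hP : IsPrimeTheory P) :
    ∃ g, Represents P g := by
  let : Preorder QG :=
    { le := fun α β => α.imp β ∈ P, le_refl := hP.imp_refl, le_trans := fun _ _ _ => hP.imp_trans }
  let : BoundedOrder QG :=
    { top := QG.top, bot := QG.bot, le_top := fun _ => hP.imp_of_mem hP.top_mem,
      bot_le := hP.bot_imp }
  have : Std.Total (α := QG) (· ≤ ·) := ⟨fun α β => hP.mem_or_mem (hP.ax (.prel α β))⟩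
  obtain ⟨g, le_iff, map_bot, map_top⟩ :=
    exists_unitInterval_le_iff_le (A := QG) fun h => hP.bot_notMem (hP.mp hP.top_mem h)
  exact ⟨g, le_iff, map_bot, map_top⟩

/-- A map from two-layered formulas to `[0,1]` that commutes with the bi-Gödel connectives. -/
structure IsBiGHom (g : QG → unitInterval) : Prop where
  map_and (α β : QG) : g (α.and β) = min (g α) (g β)
  map_or (α β : QG) : g (α.or β) = max (g α) (g β)
  map_imp (α β : QG) : g (α.imp β) = gImp (g α) (g β)
  map_coimp (α β : QG) : g (α.coimp β) = gCoimp (g α) (g β)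

namespace Represents

variable {P : Set QG} {g : QG → unitInterval} (hg : Represents P g) (hP : IsTheory P)
include hg hP

theorem eq_one_iff_mem (α : QG) : g α = 1 ↔ α ∈ P := by
  rw [← one_le_iff_eq_one, ← hg.map_top, hg.le_iff]
  exact ⟨hP.mp hP.top_mem, hP.imp_of_mem⟩

theorem map_and (α β : QG) : g (α.and β) = min (g α) (g β) := by
  refine le_antisymm (le_min ((hg.le_iff _ _).2 (hP.and_left α β))
    ((hg.le_iff _ _).2 (hP.and_right α β))) ?_
  rcases le_total (g α) (g β) with h | h
  · exact min_le_of_left_le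
      ((hg.le_iff _ _).2 (hP.imp_and (hP.imp_refl _) ((hg.le_iff _ _).1 h)))
  · exact min_le_of_right_le
      ((hg.le_iff _ _).2 (hP.imp_and ((hg.le_iff _ _).1 h) (hP.imp_refl _)))

theorem map_or (α β : QG) : g (α.or β) = max (g α) (g β) := by
  refine le_antisymm ?_ (max_le ((hg.le_iff _ _).2 (hP.or_left α β))
    ((hg.le_iff _ _).2 (hP.or_right α β)))
  rcases le_total (g α) (g β) with h | h
  · exact le_max_of_le_right
      ((hg.le_iff _ _).2 (hP.or_imp ((hg.le_iff _ _).1 h) (hP.imp_refl _)))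
  · exact le_max_of_le_left
      ((hg.le_iff _ _).2 (hP.or_imp (hP.imp_refl _) ((hg.le_iff _ _).1 h)))

theorem map_imp (α β : QG) : g (α.imp β) = gImp (g α) (g β) := by
  apply le_antisymm
  · rw [le_gImp_iff, ← hg.map_and hP, hg.le_iff]
    exact hP.uncurry (hP.imp_refl _)
  · rw [gImp]
    split_ifs with h
    · exact ((hg.eq_one_iff_mem hP _).2 ((hg.le_iff _ _).1 h)).ge
    · exact (hg.le_iff _ _).2 (hP.imp_imp_left _ _)

theorem map_coimp (α β : QG) : g (α.coimp β) = gCoimp (g α) (g β) := by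
  apply le_antisymm
  · rw [gCoimp]
    split_ifs with h
    · rw [← hg.map_bot, hg.le_iff]
      exact hP.coimp_imp_of_imp_or (hP.imp_trans ((hg.le_iff _ _).1 h) (hP.or_left _ _))
    · exact (hg.le_iff _ _).2 (hP.coimp_imp_of_imp_or (hP.or_right _ _))
  · rw [gCoimp_le_iff, ← hg.map_or hP, hg.le_iff]
    exact hP.imp_or_coimp α β

theorem isBiGHom : IsBiGHom g :=
  ⟨hg.map_and hP, hg.map_or hP, hg.map_imp hP, hg.map_coimp hP⟩

end Represents

/-! ### The frame of truth assignments -/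

/-- The propositional variables occurring in a classical formula. -/
def CPL.vars : CPL → Finset ℕ
  | var p => {p}
  | neg φ => φ.vars
  | and φ χ => φ.vars ∪ χ.vars

/-- The propositional variables occurring in a two-layered formula. -/
def QG.vars : QG → Finset ℕ
  | B φ => φ.vars
  | and α β => α.vars ∪ β.vars
  | or α β => α.vars ∪ β.vars
  | imp α β => α.vars ∪ β.vars
  | coimp α β => α.vars ∪ β.vars

theorem CPL.holds_congr {a b : ℕ → Prop} {φ : CPL} (h : ∀ p ∈ φ.vars, (a p ↔ b p)) :
    Holds a φ ↔ Holds b φ := by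
  induction φ with
  | var p => exact h p (Finset.mem_singleton_self p)
  | neg φ ih => exact not_congr (ih h)
  | and φ χ ihφ ihχ =>
    exact and_congr (ihφ fun p hp => h p (Finset.mem_union_left _ hp))
      (ihχ fun p hp => h p (Finset.mem_union_right _ hp))

theorem Frame.eval_eq_of_isBiGHom {F : Frame.{u}} {v : ℕ → Set F.W} {g : QG → unitInterval}
    (hg : IsBiGHom g) {s : Finset ℕ}
    (hB : ∀ φ : CPL, φ.vars ⊆ s → F.μ (CPL.ext v φ) = g (.B φ)) {α : QG} (hα : α.vars ⊆ s) :
    F.eval v α = g α := by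
  induction α with
  | B φ => exact hB φ hα
  | and α β ihα ihβ =>
    rw [QG.vars, Finset.union_subset_iff] at hα
    rw [eval_and, ihα hα.1, ihβ hα.2, hg.map_and]
  | or α β ihα ihβ =>
    rw [QG.vars, Finset.union_subset_iff] at hα
    rw [eval_or, ihα hα.1, ihβ hα.2, hg.map_or]
  | imp α β ihα ihβ =>
    rw [QG.vars, Finset.union_subset_iff] at hα
    rw [eval_imp, ihα hα.1, ihβ hα.2, hg.map_imp]
  | coimp α β ihα ihβ =>
    rw [QG.vars, Finset.union_subset_iff] at hα
    rw [eval_coimp, ihα hα.1, ihβ hα.2, hg.map_coimp]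

section Assignments

variable {s : Finset ℕ}

open Classical in
/-- The full disjunctive normal form of a set of truth assignments to the variables in `s`. -/
noncomputable def definingFormula (X : Set (s → Prop)) : CPL :=
  CPL.disjOver {b | b ∈ X} fun b =>
    CPL.conjOver Finset.univ fun p : s => if b p then .var p else .neg (.var p)

theorem holds_definingFormula {a : ℕ → Prop} {X : Set (s → Prop)} :
    CPL.Holds a (definingFormula X) ↔ (fun p : s => a p) ∈ X := by
  classical
  have holds_literal (b : s → Prop) (p : s) :
      CPL.Holds a (if b p then .var p else .neg (.var p)) ↔ (b p ↔ a p) := by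
    split_ifs with h <;> simp [h, CPL.Holds]
  have eq_iff (b : s → Prop) : (∀ p, b p ↔ a p) ↔ b = fun p : s => a p := by
    simp only [funext_iff, eq_iff_iff]
  simp only [definingFormula, CPL.holds_disjOver, CPL.holds_conjOver, holds_literal,
    Finset.mem_univ, true_imp_iff, eq_iff, Finset.mem_filter_univ, exists_eq_right]

variable {g : CPL → unitInterval}

/-- An uncertainty measure on classical formulas; monotonicity makes it invariant under logical
equivalence. -/
structure IsFormulaMeasure (g : CPL → unitInterval) : Prop where
  mono {φ χ : CPL} : (φ.imp χ).IsTheorem → g φ ≤ g χ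
  nontriv : g .bot < g .top

theorem IsFormulaMeasure.congr (hg : IsFormulaMeasure g) {φ χ : CPL}
    (h : ∀ a, CPL.Holds a φ ↔ CPL.Holds a χ) : g φ = g χ :=
  le_antisymm (hg.mono fun a => (CPL.holds_imp a φ χ).2 (h a).1)
    (hg.mono fun a => (CPL.holds_imp a χ φ).2 (h a).2)

/-- The frame of all truth assignments to the variables in `s`, every set of which is defined by a
formula and measured accordingly. -/
noncomputable def assignmentFrame (hg : IsFormulaMeasure g) (s : Finset ℕ) : Frame.{u} where
  W := ULift.{u} (s → Prop)
  nonempty := ⟨⟨fun _ => True⟩⟩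
  μ X := g (definingFormula (ULift.up ⁻¹' X))
  mono X Y h := hg.mono fun a => by
    simp only [CPL.holds_imp, holds_definingFormula]
    exact fun ha => h ha
  nontriv := by
    have empty_eq : g (definingFormula (ULift.up ⁻¹' ∅ : Set (s → Prop))) = g .bot :=
      hg.congr fun a => by simp [holds_definingFormula]
    have univ_eq : g (definingFormula (ULift.up ⁻¹' Set.univ : Set (s → Prop))) = g .top :=
      hg.congr fun a => by simp [holds_definingFormula]
    exact empty_eq.trans_lt (hg.nontriv.trans_eq univ_eq.symm)

/-- The valuation of `assignmentFrame` under which a variable in `s` is true at the assignments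
making it true; the other variables are false everywhere. -/
def assignmentVal (s : Finset ℕ) (p : ℕ) : Set (ULift.{u} (s → Prop)) :=
  {w | ∃ hp : p ∈ s, w.down ⟨p, hp⟩}

theorem assignmentFrame_μ_ext (hg : IsFormulaMeasure g) {φ : CPL} (hφ : φ.vars ⊆ s) :
    (assignmentFrame.{u} hg s).μ (CPL.ext (assignmentVal s) φ) = g φ := by
  refine hg.congr fun a => holds_definingFormula.trans ?_
  refine (CPL.mem_ext (assignmentVal s)).trans (CPL.holds_congr fun p hp => ?_)
  exact ⟨fun ⟨_, h⟩ => h, fun h => ⟨hφ hp, h⟩⟩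

theorem satisfiesKPS_assignmentFrame (hg : IsFormulaMeasure g)
    (hkps : ∀ (m : ℕ) (φ χ : Fin (m + 1) → CPL), (sameCount φ χ).IsTheorem →
      (∀ j : Fin m, g (φ j.castSucc) ≤ g (χ j.castSucc)) →
      g (χ (Fin.last m)) ≤ g (φ (Fin.last m))) :
    (assignmentFrame.{u} hg s).SatisfiesKPS := by
  intro m X Y hle hcount
  refine hkps m (fun i => definingFormula (ULift.up ⁻¹' X i))
    (fun i => definingFormula (ULift.up ⁻¹' Y i)) (fun a => ?_) hle
  simp only [CPL.holds_sameCount, holds_definingFormula]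
  exact hcount ⟨fun p => a p⟩

end Assignments

/-! ### Completeness -/

namespace Represents

variable {P : Set QG} {g : QG → unitInterval} (hg : Represents P g) (hP : IsTheory P)
include hg hP

theorem isFormulaMeasure (hHQG : HQG ⊆ P) : IsFormulaMeasure fun φ => g (.B φ) where
  mono h := (hg.le_iff _ _).2 (hHQG (.reg _ _ h))
  nontriv := by
    have neg_delta_mem : (((QG.B .top).imp (.B .bot)).delta).neg ∈ P :=
      hHQG (.nontriv _ _ CPL.holds_top fun a => by simp)
    have bot_notMem : QG.bot ∉ P := by
      rw [← hg.eq_one_iff_mem hP, hg.map_bot]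
      exact zero_ne_one
    refine not_le.1 fun h => bot_notMem ?_
    exact hP.mp (hP.nec ((hg.le_iff _ _).1 h)) neg_delta_mem

theorem le_last_of_isTheorem_sameCount (hHQG : HQG ⊆ P) (hKPS : KPS ⊆ P) (m : ℕ)
    (φ χ : Fin (m + 1) → CPL) (hcount : (sameCount φ χ).IsTheorem)
    (hle : ∀ j : Fin m, g (.B (φ j.castSucc)) ≤ g (.B (χ j.castSucc))) :
    g (.B (χ (Fin.last m))) ≤ g (.B (φ (Fin.last m))) := by
  have eG_mem : eG φ χ ∈ P :=
    hP.nec (hP.and_mem (hHQG (.reg _ _ fun a => by simp)) (hHQG (.reg _ _ fun a => by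
      simp [hcount a])))
  have premises_mem : QG.bigAnd ((List.finRange m).map fun i =>
      QG.delta ((QG.B (φ i.castSucc)).imp (.B (χ i.castSucc)))) ∈ P := by
    refine hP.bigAnd_mem (List.forall_mem_map.2 fun j _ => ?_)
    exact hP.nec ((hg.le_iff _ _).1 (hle j))
  have conclusion_mem := hP.mp (hP.and_mem eG_mem premises_mem) (hKPS ⟨m, φ, χ, rfl⟩)
  exact (hg.le_iff _ _).2 (hP.mp conclusion_mem (hP.delta_imp _))

end Represents

theorem IsTheory.exists_countermodel {T : Set QG} (hT : IsTheory T) (hHQG : HQG ⊆ T)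
    (hKPS : KPS ⊆ T) {α : QG} (hα : α ∉ T) :
    ∃ F : Frame.{u}, F.SatisfiesKPS ∧ ∃ v : ℕ → Set F.W, F.eval v α ≠ 1 := by
  obtain ⟨P, hTP, hP, hαP⟩ := hT.exists_isPrimeTheory_notMem hα
  obtain ⟨g, hg⟩ := hP.exists_represents
  have hPT := hP.toIsTheory
  have hμ := hg.isFormulaMeasure hPT (hHQG.trans hTP)
  have truth_lemma : (assignmentFrame.{u} hμ α.vars).eval (assignmentVal α.vars) α = g α :=
    Frame.eval_eq_of_isBiGHom (hg.isBiGHom hPT) (fun _ => assignmentFrame_μ_ext hμ) subset_rfl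
  refine ⟨assignmentFrame hμ α.vars, satisfiesKPS_assignmentFrame hμ
    (hg.le_last_of_isTheorem_sameCount hPT (hHQG.trans hTP) (hKPS.trans hTP)),
    assignmentVal α.vars, ?_⟩
  rwa [truth_lemma, Ne, hg.eq_one_iff_mem hPT]

theorem isTheory_derives_HQG_union_KPS : IsTheory {α | Derives (HQG ∪ KPS) ∅ α} :=
  isTheory_derives fun α h => .inl (HQGAxiom.biG α h)

theorem derives_iff_validates (α : QG) :
    Derives (HQG ∪ KPS) ∅ α ↔ ∀ F : Frame.{u}, IsQPGFrame F → F.Validates α := by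
  refine ⟨fun h F hF => h.validates (Frame.SatisfiesKPS.validates_axiom hF), fun h => ?_⟩
  by_contra hα
  obtain ⟨F, hF, v, hv⟩ := isTheory_derives_HQG_union_KPS.exists_countermodel.{u}
    (fun _ h => .ax (.inl h)) (fun _ h => .ax (.inr h)) hα
  exact hv (h F hF v)

namespace Derives

variable {Ax Ξ Ξ' : Set QG}

theorem mono {α : QG} (hΞ : Ξ ⊆ Ξ') (h : Derives Ax Ξ α) : Derives Ax Ξ' α := by
  induction h with
  | ax h => exact .ax h
  | prem h => exact .prem (hΞ h)
  | mp _ _ ih ih' => exact .mp (ih hΞ) (ih' hΞ)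
  | nec h _ => exact .nec h

theorem bigAnd (hAx : ∀ α, BiGAxiom α → α ∈ Ax) {l : List QG} (h : ∀ γ ∈ l, Derives Ax Ξ γ) :
    Derives Ax Ξ (QG.bigAnd l) := by
  have hT := isTheory_derives hAx
  induction l with
  | nil => exact mono (Set.empty_subset Ξ) hT.top_mem
  | cons γ l ih =>
    rw [List.forall_mem_cons] at h
    exact .mp (ih h.2) (.mp h.1 (mono (Set.empty_subset Ξ) (hT.imp_imp_and _ _)))

end Derives

theorem derives_iff_entailsQPG {Ξ : Set QG} (hΞ : Ξ.Finite) (α : QG) :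
    Derives (HQG ∪ KPS) Ξ α ↔ EntailsQPG.{u} Ξ α := by
  refine ⟨fun h F hF v => h.sInf_le_eval (Frame.SatisfiesKPS.validates_axiom hF) v, fun h => ?_⟩
  have mem_toList (γ : QG) : γ ∈ hΞ.toFinset.toList ↔ γ ∈ Ξ := by simp
  have premises : Derives (HQG ∪ KPS) Ξ (QG.bigAnd hΞ.toFinset.toList) :=
    .bigAnd (fun β h => .inl (HQGAxiom.biG β h)) fun γ hγ => .prem ((mem_toList γ).1 hγ)
  have implication : Derives (HQG ∪ KPS) ∅ ((QG.bigAnd hΞ.toFinset.toList).imp α) := by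
    refine (derives_iff_validates.{u} _).2 fun F hF v => ?_
    rw [Frame.eval_imp_eq_one]
    refine (le_sInf ?_).trans (h F hF v)
    exact Set.forall_mem_image.2 fun γ hγ => Frame.le_eval_bigAnd.1 le_rfl γ ((mem_toList γ).2 hγ)
  exact .mp premises (implication.mono (Set.empty_subset Ξ))

end QualProb

theorem mainTheorem2 :
    (∀ F : QualProb.Frame.{u},
      (∀ α ∈ QualProb.KPS, F.Validates α) ↔ F.SatisfiesKPS) ∧
    (∀ α : QualProb.QG,
      QualProb.Derives (QualProb.HQG ∪ QualProb.KPS) ∅ α ↔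
        ∀ F : QualProb.Frame.{u}, QualProb.IsQPGFrame F → F.Validates α) ∧
    (∀ (Ξ : Set QualProb.QG) (α : QualProb.QG), Ξ.Finite →
      (QualProb.Derives (QualProb.HQG ∪ QualProb.KPS) Ξ α ↔
        QualProb.EntailsQPG.{u} Ξ α)) :=
  ⟨fun _ => QualProb.Frame.validates_kps_iff_satisfiesKPS, QualProb.derives_iff_validates,
    fun _ α hΞ => QualProb.derives_iff_entailsQPG hΞ α⟩
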